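/- Let $V\subset V'$ be an immediate extension of valuation rings with fraction fields $K\subset K'$; that is, the inclusion is a local homomorphism and induces isomorphisms of the residue fields and of the value groups. Assume that $K'=K(x)$ for some $x\in K'$ (algebraic or transcendental over $K$). Then $V'$ is a filtered union of complete intersection $V$-subalgebras: there is a nonempty family of $V$-subalgebras of $V'$, directed by inclusion and with union $V'$, each member of which is a complete intersection $V$-algebra. Here a $V$-algebra is called a complete intersection if it is isomorphic to $G/(P)$ for a smooth $V$-algebra $G$ and a (finite) regular sequence $P$ of elements of $G$; this includes the nonzero algebras $T_h/(P)$ with $T$ a polynomial $V$-algebra in finitely many variables, $0\neq h\in T$ and $P$ a regular sequence in $T$. Flatness over $V$ is not part of the definition. -/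

import Mathlib

universe u v w

namespace PopescuVal

section Immediate

variable (V : Type*) (V' : Type*) (K : Type*) (K' : Type*)
  [CommRing V] [CommRing V'] [Field K] [Field K']
  [Algebra V K] [Algebra V' K'] [Algebra V V'] [Algebra K K'] [Algebra V K']
  [IsScalarTower V V' K'] [IsScalarTower V K K']

/-- The map of value groups (with zero adjoined) `K / Vˣ → K' / V'ˣ` induced by the inclusion
`K → K'`. -/
def valueGroupMap : ValuationRing.ValueGroup V K → ValuationRing.ValueGroup V' K' :=
  Quotient.map' (algebraMap K K') (by
    rintro a b ⟨c, rfl⟩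
    refine ⟨Units.map (algebraMap V V').toMonoidHom c, ?_⟩
    simp only [Units.smul_def, Algebra.smul_def, Units.coe_map, MonoidHom.coe_coe,
      RingHom.toMonoidHom_eq_coe, map_mul]
    rw [← IsScalarTower.algebraMap_apply V V' K', ← IsScalarTower.algebraMap_apply V K K'])

/-- `V ⊆ V'` is an immediate extension of valuation rings, with fraction fields `K ⊆ K'`:
the inclusion is local and induces isomorphisms of the residue fields and of the value groups.
(The two induced maps are always homomorphisms, the second one is monotone, and it sends zero
to zero and the value group `Kˣ / Vˣ` to the value group `K'ˣ / V'ˣ`; so it is enough to ask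
that they are bijective.) -/
structure IsImmediateExtension [IsLocalRing V] [IsLocalRing V'] : Prop where
  injective : Function.Injective (algebraMap V V')
  isLocalHom : IsLocalHom (algebraMap V V')
  bijective_residueField :
    Function.Bijective (IsLocalRing.ResidueField.map (algebraMap V V'))
  bijective_valueGroup : Function.Bijective (valueGroupMap V V' K K')

end Immediate

/-- `B` is a complete intersection `A`-algebra: it is isomorphic to `G ⧸ (P)` for a smooth
`A`-algebra `G` and a regular sequence `P` of elements of `G`. Flatness over `A` is not required.
(The localization `T_h` of a polynomial `A`-algebra `T` in finitely many variables is smooth, so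
this includes the algebras `T_h ⧸ (P)`.) -/
def IsCompleteIntersectionAlgebra (A : Type u) (B : Type v) [CommRing A] [CommRing B]
    [Algebra A B] : Prop :=
  ∃ (G : Type u) (_ : CommRing G) (_ : Algebra A G) (P : List G),
    Algebra.Smooth A G ∧ RingTheory.Sequence.IsRegular G P ∧
      Nonempty ((G ⧸ Ideal.ofList P) ≃ₐ[A] B)

/-- The `A`-algebra `B` is the filtered union of a family of `A`-subalgebras each of which is a
complete intersection `A`-algebra. -/
def IsFilteredUnionOfCompleteIntersections (A : Type u) (B : Type v) [CommRing A] [CommRing B]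
    [Algebra A B] : Prop :=
  ∃ S : Set (Subalgebra A B), S.Nonempty ∧ DirectedOn (· ≤ ·) S ∧
    (∀ C ∈ S, IsCompleteIntersectionAlgebra A C) ∧ ∀ b : B, ∃ C ∈ S, b ∈ C

end PopescuVal

/-! Let `A` be the localization of `K[X]` at the kernel of evaluation at `x`, and build
`V`-subalgebras of `A` before mapping them to `K'`; inverting `x` if necessary, assume that `x` is
integral. Start from the polynomial ring `V[X]` and adjoin only quotients `z = h/d` with `h` regular
modulo `d`, and inverses. Each step has the form `C[Z]/(dZ - h)`, so complete intersections persist.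

The construction is an induction on degree (`exists_isAdmissible`). For a finite set of polynomials,
those of degree below `N` become constants times units, and all of them become constants times
elements regular modulo every nonzero `δ` in `V`. To pass degree `N`, immediacy gives a monic `h` of
degree `N` whose value at `x` is as small as needed (`exists_monic_lt`). Expand the polynomials in
powers of `h`, and adjoin `h` rescaled to value one. After normalization each expansion has a unit
coefficient, which keeps it fiber regular (`IsFiberRegular.adjoinElem`). A polynomial of degree `N`
is now a constant times an element of value one, which may be inverted.

If `x` is transcendental, evaluation is injective on the result. If `x` is algebraic, its kernel is
generated up to torsion by the minimal polynomial; fiber regularity removes the torsion, so the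
image is the quotient by one more nonzerodivisor. -/

namespace PopescuVal

open Polynomial

/-! ### Stability properties of complete intersection algebras. -/

section CompleteIntersection

variable {V : Type u} [CommRing V] {B : Type v} [CommRing B] [Algebra V B]

theorem IsCompleteIntersectionAlgebra.of_algEquiv {C : Type w} [CommRing C] [Algebra V C]
    (h : IsCompleteIntersectionAlgebra V B) (e : B ≃ₐ[V] C) :
    IsCompleteIntersectionAlgebra V C := by
  obtain ⟨G, _, _, P, hs, hP, ⟨e'⟩⟩ := h
  exact ⟨G, _, _, P, hs, hP, ⟨e'.trans e⟩⟩

theorem IsCompleteIntersectionAlgebra.self (V : Type u) [CommRing V] [Nontrivial V] :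
    IsCompleteIntersectionAlgebra V V :=
  ⟨V, _, _, [], inferInstance, RingTheory.Sequence.IsRegular.nil V V,
    ⟨(Ideal.quotientEquivAlgOfEq V (by simp)).trans (AlgEquiv.quotientBot V V)⟩⟩

theorem IsCompleteIntersectionAlgebra.finiteType (h : IsCompleteIntersectionAlgebra V B) :
    Algebra.FiniteType V B := by
  obtain ⟨G, _, _, P, hs, hP, ⟨e⟩⟩ := h
  have : Algebra.FiniteType V G := inferInstance
  exact (this.of_surjective (Ideal.Quotient.mkₐ V (Ideal.ofList P))
    (Ideal.Quotient.mkₐ_surjective V _)).equiv e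

/-- A lift of `a` to the smooth algebra is appended to the regular sequence; `ha'` keeps the
extended sequence from generating the unit ideal. -/
theorem IsCompleteIntersectionAlgebra.quotient (h : IsCompleteIntersectionAlgebra V B) {a : B}
    (ha : ∀ b, a * b = 0 → b = 0) (ha' : ¬ IsUnit a) :
    IsCompleteIntersectionAlgebra V (B ⧸ Ideal.span {a}) := by
  obtain ⟨G, _, _, P, hs, hP, ⟨e⟩⟩ := h
  obtain ⟨g, hg⟩ := Ideal.Quotient.mk_surjective (e.symm a)
  have e2 : (G ⧸ (Ideal.ofList (P ++ [g]))) ≃ₐ[V] (B ⧸ Ideal.span {a}) := by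
    refine (Ideal.quotientEquivAlgOfEq V (by rw [Ideal.ofList_append])).trans
      ((DoubleQuot.quotQuotEquivQuotSupₐ V (Ideal.ofList P) (Ideal.ofList [g])).symm.trans
        (Ideal.quotientEquivAlg _ _ e ?_))
    rw [Ideal.ofList_singleton, Ideal.map_span, Ideal.map_span]
    simp [hg]
  refine ⟨G, _, _, P ++ [g], hs, ⟨?_, ?_⟩, ⟨e2⟩⟩
  · rw [RingTheory.Sequence.isWeaklyRegular_append_iff]
    refine ⟨hP.1, ?_⟩
    rw [RingTheory.Sequence.isWeaklyRegular_singleton_iff]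
    refine IsSMulRegular.of_right_eq_zero_of_smul fun q hq => ?_
    obtain ⟨y, rfl⟩ := Submodule.Quotient.mk_surjective _ q
    rw [← Submodule.Quotient.mk_smul, Submodule.Quotient.mk_eq_zero] at hq
    rw [Submodule.Quotient.mk_eq_zero]
    simp only [smul_eq_mul, Ideal.mul_top] at hq ⊢
    rw [← Ideal.Quotient.eq_zero_iff_mem] at hq ⊢
    apply e.injective
    rw [map_zero]
    apply ha
    rw [map_mul, hg] at hq
    simpa using congrArg e hq
  · intro htop
    rw [Ideal.smul_eq_mul, Ideal.mul_top] at htop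
    rw [← htop] at e2
    have : Subsingleton (B ⧸ Ideal.span {a}) :=
      e2.symm.injective.subsingleton
    rw [Ideal.Quotient.subsingleton_iff, Ideal.span_singleton_eq_top] at this
    exact ha' this

/-- `G → G[X]` is smooth and faithfully flat, so a regular sequence in `G` stays regular in `G[X]`.
-/
theorem IsCompleteIntersectionAlgebra.polynomial (h : IsCompleteIntersectionAlgebra V B) :
    IsCompleteIntersectionAlgebra V B[X] := by
  obtain ⟨G, _, _, P, hs, hP, ⟨e⟩⟩ := h
  have : Algebra.FinitePresentation G G[X] := .polynomial G G
  have : Algebra.Smooth G G[X] := { }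
  have : Nontrivial G := hP.nontrivial
  refine ⟨G[X], _, _, P.map C, Algebra.Smooth.comp V G G[X],
    hP.of_faithfullyFlat, ⟨?_⟩⟩
  refine (Ideal.quotientEquivAlgOfEq V (Ideal.map_ofList _ P).symm).trans
    (AlgEquiv.trans (AlgEquiv.ofRingEquiv (f := (Ideal.polynomialQuotientEquivQuotientPolynomial (Ideal.ofList P)).symm) fun r => ?_)
     (Polynomial.mapAlgEquiv e))
  rw [RingEquiv.symm_apply_eq, Polynomial.algebraMap_apply]
  have := Ideal.polynomialQuotientEquivQuotientPolynomial_map_mk (Ideal.ofList P)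
    (C (algebraMap V G r))
  rw [Polynomial.map_C] at this
  exact this.symm

end CompleteIntersection

end PopescuVal

/-! ### The algebra `C[z]` with `d * z = h`, and its presentation. -/

namespace PopescuVal

open Polynomial

section AdjoinElem

variable {V : Type u} [CommRing V] {A : Type v} [CommRing A] [Algebra V A]

/-- The subalgebra `C[z]` of `A`. -/
noncomputable def adjoinElem (C : Subalgebra V A) (z : A) : Subalgebra V A :=
  ((aeval z : C[X] →ₐ[C] A).restrictScalars V).range

variable {C : Subalgebra V A} {z : A}

theorem mem_adjoinElem {y : A} : y ∈ adjoinElem C z ↔ ∃ p : C[X], aeval z p = y := Iff.rfl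

theorem le_adjoinElem : C ≤ adjoinElem C z := fun y hy =>
  mem_adjoinElem.2 ⟨Polynomial.C ⟨y, hy⟩, by simp⟩

theorem self_mem_adjoinElem : z ∈ adjoinElem C z := mem_adjoinElem.2 ⟨X, by simp⟩

theorem adjoinElem_induction {P : A → Prop} (hC : ∀ c ∈ C, ∀ n, P (c * z ^ n))
    (hadd : ∀ a b, P a → P b → P (a + b)) {y : A} (hy : y ∈ adjoinElem C z) : P y := by
  obtain ⟨p, rfl⟩ := mem_adjoinElem.1 hy
  induction p using Polynomial.induction_on' with
  | add p q hp hq =>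
    rw [map_add]
    exact hadd _ _ (hp (mem_adjoinElem.2 ⟨p, rfl⟩)) (hq (mem_adjoinElem.2 ⟨q, rfl⟩))
  | monomial n a =>
    rw [aeval_monomial]
    exact hC _ a.2 n

/-- `C` and `C[z]` agree once `d` is inverted; this moves questions about `C[z]` back to `C`. -/
theorem exists_pow_mul_mem {d h : A} (hd : d ∈ C) (hh : h ∈ C) (hz : d * z = h) {y : A}
    (hy : y ∈ adjoinElem C z) : ∃ n, d ^ n * y ∈ C := by
  refine adjoinElem_induction (P := fun y => ∃ n, d ^ n * y ∈ C) ?_ ?_ hy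
  · intro c hc n
    refine ⟨n, ?_⟩
    have : d ^ n * (c * z ^ n) = c * h ^ n := by rw [← hz]; ring
    rw [this]
    exact mul_mem hc (pow_mem hh n)
  · rintro a b ⟨n, hn⟩ ⟨m, hm⟩
    refine ⟨n + m, ?_⟩
    have : d ^ (n + m) * (a + b) = d ^ m * (d ^ n * a) + d ^ n * (d ^ m * b) := by ring
    rw [this]
    exact add_mem (mul_mem (pow_mem hd m) hn) (mul_mem (pow_mem hd n) hm)

section Kernel

variable {d h : C} (hz : (d : A) * z = h)

include hz in
-- Since `d ^ n * z ^ n = h ^ n`, every term of degree below `n` keeps a factor `d`, and only the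
-- top one survives modulo `d`.
theorem exists_pow_mul_aeval (n : ℕ) (p : C[X]) (hp : p.natDegree ≤ n) :
    ∃ r : C, (d : A) ^ n * aeval z p = ((p.coeff n * h ^ n + d * r : C) : A) := by
  induction n generalizing p with
  | zero =>
    refine ⟨0, ?_⟩
    rw [eq_C_of_natDegree_le_zero hp]
    simp
  | succ n ih =>
    have hdeg : (p - Polynomial.C (p.coeff (n + 1)) * X ^ (n + 1)).natDegree ≤ n := by
      rw [natDegree_le_iff_coeff_eq_zero]
      intro m hm
      rcases (Nat.succ_le_of_lt hm).eq_or_lt with rfl | hm'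
      · simp
      · rw [coeff_sub, coeff_C_mul, coeff_X_pow, if_neg (by omega), mul_zero, sub_zero]
        exact coeff_eq_zero_of_natDegree_lt (by omega)
    obtain ⟨r, hr⟩ := ih _ hdeg
    refine ⟨(p - Polynomial.C (p.coeff (n + 1)) * X ^ (n + 1)).coeff n * h ^ n + d * r, ?_⟩
    · have h1 : aeval z p = aeval z (p - Polynomial.C (p.coeff (n + 1)) * X ^ (n + 1)) +
          (p.coeff (n + 1) : A) * z ^ (n + 1) := by
        simp
      rw [h1, mul_add, pow_succ, mul_right_comm, hr]
      have h2 : (d : A) ^ n * d * ((p.coeff (n + 1) : A) * z ^ (n + 1)) =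
        ((p.coeff (n + 1) * h ^ (n + 1) : C) : A) := by
        push_cast
        rw [← hz]
        ring
      rw [h2, add_comm, mul_comm _ (d : A)]
      norm_cast

include hz in
-- If `p(z) = 0`, the top coefficient times a power of `h` is divisible by `d`, hence so is the top
-- coefficient. Subtracting a multiple of `dX - h` then lowers the degree.
theorem dvd_of_aeval_eq_zero (hreg : ∀ y : C, d ∣ h * y → d ∣ y)
    (p : C[X]) (hp : aeval z p = 0) : Polynomial.C d * X - Polynomial.C h ∣ p := by
  obtain ⟨n, hn⟩ : ∃ n, p.natDegree ≤ n := ⟨_, le_rfl⟩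
  induction n generalizing p with
  | zero =>
    rw [eq_C_of_natDegree_le_zero hn] at hp ⊢
    rw [aeval_C] at hp
    have : p.coeff 0 = 0 := Subtype.ext hp
    simp [this]
  | succ n ih =>
    obtain ⟨r, hr⟩ := exists_pow_mul_aeval hz (n + 1) p hn
    rw [hp, mul_zero] at hr
    have hr' : p.coeff (n + 1) * h ^ (n + 1) + d * r = 0 := Subtype.ext hr.symm
    have hdvd : ∀ k, ∀ a : C, d ∣ a * h ^ k → d ∣ a := by
      intro k
      induction k with
      | zero => simp
      | succ k ihk =>
        intro a ha
        exact ihk a (hreg _ (by rwa [mul_left_comm, ← pow_succ']))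
    obtain ⟨b, hb⟩ := hdvd (n + 1) (p.coeff (n + 1)) ⟨-r, by linear_combination hr'⟩
    have hq : Polynomial.C d * X - Polynomial.C h ∣
        p - (Polynomial.C d * X - Polynomial.C h) * (Polynomial.C b * X ^ n) := by
      apply ih
      · have h0 : aeval z (Polynomial.C d * X - Polynomial.C h) = 0 := by
          simp only [map_sub, map_mul, aeval_C, aeval_X]
          exact sub_eq_zero.2 hz
        rw [map_sub, map_mul, h0, hp, zero_mul, sub_zero]
      · have he : (Polynomial.C d * X - Polynomial.C h) * (Polynomial.C b * X ^ n) =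
            Polynomial.C (d * b) * X ^ (n + 1) - Polynomial.C (h * b) * X ^ n := by
          simp only [map_mul]
          ring
        rw [he, natDegree_le_iff_coeff_eq_zero]
        intro m hm
        simp only [coeff_sub, coeff_C_mul, coeff_X_pow]
        rcases (Nat.succ_le_of_lt hm).eq_or_lt with rfl | hm'
        · simp [hb]
        · rw [coeff_eq_zero_of_natDegree_lt (by omega), if_neg (by omega), if_neg (by omega)]
          simp
    exact (dvd_sub_left (dvd_mul_right _ _)).1 hq

theorem isCompleteIntersectionAlgebra_adjoinElem [IsDomain A]
    (hC : IsCompleteIntersectionAlgebra V C) (hd : d ≠ 0) (hz : (d : A) * z = h)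
    (hreg : ∀ y : C, d ∣ h * y → d ∣ y) :
    IsCompleteIntersectionAlgebra V (adjoinElem C z) := by
  let φ : C[X] →ₐ[V] A := (aeval z : C[X] →ₐ[C] A).restrictScalars V
  have hker : RingHom.ker φ = Ideal.span {Polynomial.C d * X - Polynomial.C h} := by
    ext p
    rw [RingHom.mem_ker, Ideal.mem_span_singleton]
    refine ⟨fun hp => dvd_of_aeval_eq_zero hz hreg p hp, ?_⟩
    rintro ⟨q, rfl⟩
    rw [map_mul]
    have : φ (Polynomial.C d * X - Polynomial.C h) = 0 := by
      change aeval z (Polynomial.C d * X - Polynomial.C h) = 0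
      simp only [map_sub, map_mul, aeval_C, aeval_X]
      exact sub_eq_zero.2 hz
    rw [this, zero_mul]
  have hne : Polynomial.C d * X - Polynomial.C h ≠ 0 := fun h0 => hd (by
    simpa using congrArg (fun p => coeff p 1) h0)
  refine (hC.polynomial.quotient (a := Polynomial.C d * X - Polynomial.C h)
    (fun b hb => (mul_eq_zero.1 hb).resolve_left hne) ?_).of_algEquiv
    ((Ideal.quotientEquivAlgOfEq V hker.symm).trans (Ideal.quotientKerEquivRange φ))
  intro hu
  rw [← Ideal.span_singleton_eq_top, ← hker] at hu
  exact RingHom.ker_ne_top _ hu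

end Kernel

end AdjoinElem

end PopescuVal

/-! ### Regularity in the fibers. -/

namespace PopescuVal

open Polynomial

/-- McCoy: a zero divisor in `(R ⧸ I)[X]` is killed by a nonzero constant, which a unit coefficient
excludes. -/
theorem mem_map_C_of_mul_mem {R : Type*} [CommRing R] {I : Ideal R} {g y : R[X]} {i : ℕ}
    (hi : IsUnit (g.coeff i)) (h : g * y ∈ I.map (C : R →+* R[X])) :
    y ∈ I.map (C : R →+* R[X]) := by
  have key : ∀ p : R[X], p ∈ I.map (C : R →+* R[X]) ↔ p.map (Ideal.Quotient.mk I) = 0 := by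
    intro p
    rw [Ideal.mem_map_C_iff, Polynomial.ext_iff]
    simp [Ideal.Quotient.eq_zero_iff_mem]
  rw [key] at h ⊢
  rw [Polynomial.map_mul] at h
  have hg : g.map (Ideal.Quotient.mk I) ∈ nonZeroDivisors (R ⧸ I)[X] := by
    apply mem_nonzeroDivisors_of_coeff_mem i
    rw [coeff_map]
    exact (hi.map _).mem_nonZeroDivisors
  exact (mul_left_mem_nonZeroDivisors_eq_zero_iff hg).1 h

/-- Multiplication by `f` is injective on `C ⧸ δ C` for all nonzero `δ` in the base ring. -/
def IsFiberRegular {V : Type u} [CommRing V] {A : Type v} [CommRing A] [Algebra V A]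
    (C : Subalgebra V A) (f : A) : Prop :=
  ∀ δ : V, δ ≠ 0 → ∀ y ∈ C, ∀ b ∈ C, f * y = algebraMap V A δ * b →
    ∃ b' ∈ C, y = algebraMap V A δ * b'

section

variable {V : Type u} [CommRing V] {A : Type v} [CommRing A] [Algebra V A]
  {C : Subalgebra V A} {z : A}

/-- Modulo `d`, the ring `C[z]` is the polynomial ring over `C/(d, h)`, where a polynomial with a
unit coefficient is a nonzerodivisor. -/
theorem exists_eq_mul_of_aeval_mul_eq {d h : C} (hz : (d : A) * z = h)
    (hreg : ∀ y : C, d ∣ h * y → d ∣ y) {F : C[X]} {i : ℕ} (hi : IsUnit (F.coeff i))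
    {y b : A} (hy : y ∈ adjoinElem C z) (hb : b ∈ adjoinElem C z) (hyb : aeval z F * y = d * b) :
    ∃ b' ∈ adjoinElem C z, y = d * b' := by
  obtain ⟨Y, rfl⟩ := mem_adjoinElem.1 hy
  obtain ⟨B, rfl⟩ := mem_adjoinElem.1 hb
  obtain ⟨Q, hQ⟩ := dvd_of_aeval_eq_zero hz hreg (F * Y - Polynomial.C d * B) (by
    rw [map_sub, map_mul, map_mul, aeval_C]
    exact sub_eq_zero.2 hyb)
  have hmap : (Ideal.span {d, h}).map (Polynomial.C : C →+* C[X]) =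
      Ideal.span {Polynomial.C d, Polynomial.C h} := by
    rw [Ideal.map_span, Set.image_pair]
  have hmem : Y ∈ (Ideal.span {d, h}).map (Polynomial.C : C →+* C[X]) := by
    apply mem_map_C_of_mul_mem hi
    rw [hmap, Ideal.mem_span_pair]
    exact ⟨B + X * Q, -Q, by linear_combination -hQ⟩
  rw [hmap, Ideal.mem_span_pair] at hmem
  obtain ⟨P, R, rfl⟩ := hmem
  refine ⟨aeval z (P + R * X), mem_adjoinElem.2 ⟨_, rfl⟩, ?_⟩
  simp only [map_add, map_mul, aeval_C, aeval_X]
  change aeval z P * (d : A) + aeval z R * (h : A) = _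
  rw [← hz]
  ring

theorem IsFiberRegular.adjoin_inv {f t : A} (ht : t ∈ C) (htz : t * z = 1)
    (hf : IsFiberRegular C f) : IsFiberRegular (adjoinElem C z) f := by
  intro δ hδ y hy b hb hyb
  obtain ⟨n, hn⟩ := exists_pow_mul_mem ht (one_mem C) htz hy
  obtain ⟨m, hm⟩ := exists_pow_mul_mem ht (one_mem C) htz hb
  obtain ⟨b', hb', h⟩ := hf δ hδ (t ^ m * (t ^ n * y)) (mul_mem (pow_mem ht m) hn)
    (t ^ n * (t ^ m * b)) (mul_mem (pow_mem ht n) hm)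
    (by linear_combination t ^ m * t ^ n * hyb)
  refine ⟨z ^ (m + n) * b', mul_mem (pow_mem self_mem_adjoinElem _) (le_adjoinElem hb'), ?_⟩
  have h1 : z ^ (m + n) * t ^ (m + n) = 1 := by rw [← mul_pow, mul_comm z, htz, one_pow]
  calc y = z ^ (m + n) * t ^ (m + n) * y := by rw [h1, one_mul]
    _ = z ^ (m + n) * (t ^ m * (t ^ n * y)) := by ring
    _ = _ := by rw [h]; ring

theorem exists_eq_pow_mul {d f : A} (h : ∀ y ∈ C, ∀ b ∈ C, f * y = d * b → ∃ b' ∈ C, y = d * b')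
    (hd : ∀ a b, d * a = d * b → a = b) (n : ℕ) :
    ∀ y ∈ C, ∀ b ∈ C, f * y = d ^ n * b → d ∈ C → ∃ b' ∈ C, y = d ^ n * b' := by
  induction n with
  | zero => intro y hy b hb _ _; exact ⟨y, hy, by simp⟩
  | succ n ih =>
    intro y hy b hb hyb hdC
    obtain ⟨y', hy', rfl⟩ := h y hy (d ^ n * b) (mul_mem (pow_mem hdC n) hb)
      (by rw [hyb]; ring)
    obtain ⟨b', hb', rfl⟩ := ih y' hy' b hb (hd _ _ (by linear_combination hyb)) hdC
    exact ⟨b', hb', by ring⟩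

end

section

variable {V : Type u} [CommRing V] [IsDomain V] [ValuationRing V] {K : Type w} [Field K]
  [Algebra V K] [IsFractionRing V K] {A : Type v} [CommRing A] [IsDomain A]
  [Algebra V A] [Algebra K A] [IsScalarTower V K A] {C : Subalgebra V A} {z : A}

/-- Modulo powers of `d`, regularity comes from the unit coefficient of `F`. For `δ` divisible by
all powers of `d` this says nothing; there it is inherited from `f₁`, because `C` and `C[z]` agree
after inverting `d`. -/
theorem IsFiberRegular.adjoinElem {d : V} {h : A} (hh : h ∈ C) (hd : d ≠ 0)
    (hz : algebraMap V A d * z = h) (hreg : IsFiberRegular C h)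
    (hdu : ¬ ∃ w ∈ adjoinElem C z, algebraMap V A d * w = 1)
    {F : C[X]} {i : ℕ} (hi : IsUnit (F.coeff i)) {f₁ : A} (hf₁ : f₁ ∈ C)
    (hf₁reg : IsFiberRegular C f₁) {e : K} (he : e ≠ 0)
    (hF : aeval z F = algebraMap K A e * f₁) :
    IsFiberRegular (adjoinElem C z) (aeval z F) := by
  have hinj : Function.Injective (algebraMap V A) := by
    rw [IsScalarTower.algebraMap_eq V K A]
    exact (algebraMap K A).injective.comp (IsFractionRing.injective V K)
  have hinj0 : ∀ a : V, a ≠ 0 → algebraMap V A a ≠ 0 := fun a ha h0 =>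
    ha (hinj (by rw [h0, map_zero]))
  have hdA := hinj0 d hd
  have hdC : ∀ (S : Subalgebra V A) (a : V), algebraMap V A a ∈ S := fun S a => S.algebraMap_mem a
  have hstep : ∀ y ∈ PopescuVal.adjoinElem C z, ∀ b ∈ PopescuVal.adjoinElem C z,
      aeval z F * y = algebraMap V A d * b →
      ∃ b' ∈ PopescuVal.adjoinElem C z, y = algebraMap V A d * b' := by
    intro y hy b hb hyb
    refine exists_eq_mul_of_aeval_mul_eq (d := ⟨_, hdC C d⟩) (h := ⟨h, hh⟩) hz ?_ hi hy hb hyb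
    rintro ⟨y, hy⟩ ⟨⟨b, hb⟩, hyb⟩
    obtain ⟨b', hb', h'⟩ := hreg d hd y hy b hb (congrArg Subtype.val hyb)
    exact ⟨⟨b', hb'⟩, Subtype.ext h'⟩
  have hpow := fun n y hy b hb hyb => exists_eq_pow_mul hstep
    (fun a b hab => mul_left_cancel₀ hdA hab) n y hy b hb hyb (hdC _ d)
  intro δ hδ y hy b hb hyb
  by_cases hdiv : ∀ n, d ^ n ∣ δ
  -- Clear powers of `d` to land in `C` and use `f₁` there. The factor `d ^ m` so introduced also
  -- divides `δ`, and is removed at the end by `hpow`.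
  · obtain ⟨m, y₂, hy₂, hm⟩ : ∃ m, ∃ y₂ ∈ C, algebraMap V A d ^ m * y = algebraMap V A δ * y₂ := by
      obtain ⟨n₁, hn₁⟩ := exists_pow_mul_mem (hdC C d) hh hz hy
      obtain ⟨n₂, hn₂⟩ := exists_pow_mul_mem (hdC C d) hh hz hb
      set D := algebraMap V A d
      rcases ValuationRing.isInteger_or_isInteger V e with ⟨a, ha⟩ | ⟨a, ha⟩
      · have hae : algebraMap K A e = algebraMap V A a := by
          rw [← ha, ← IsScalarTower.algebraMap_apply]
        rw [hae] at hF
        -- If `a` divides `d`, one extra factor `d` absorbs the constant. If `d` divides `a`, then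
        -- `F(z)` lies in `d C[z]`; being regular modulo `d`, it would force `d` to be invertible,
        -- against `hdu`.
        rcases ValuationRing.dvd_total a d with ⟨a', rfl⟩ | ⟨a', rfl⟩
        · obtain ⟨y₂, hy₂, h'⟩ := hf₁reg δ hδ (D * (D ^ n₂ * (D ^ n₁ * y)))
            (mul_mem (hdC C _) (mul_mem (pow_mem (hdC C _) _) hn₁))
            (algebraMap V A a' * (D ^ n₁ * (D ^ n₂ * b)))
            (mul_mem (hdC C _) (mul_mem (pow_mem (hdC C _) _) hn₂)) (by
              have hD : D = algebraMap V A a * algebraMap V A a' := map_mul _ _ _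
              rw [hF] at hyb
              calc f₁ * (D * (D ^ n₂ * (D ^ n₁ * y))) =
                  D ^ n₂ * D ^ n₁ * f₁ * y * D := by ring
                _ = D ^ n₂ * D ^ n₁ * f₁ * y * (algebraMap V A a * algebraMap V A a') := by
                    rw [hD]
                _ = _ := by linear_combination D ^ n₂ * D ^ n₁ * algebraMap V A a' * hyb)
          exact ⟨1 + n₂ + n₁, y₂, hy₂, by rw [← h']; ring⟩
        · exfalso
          obtain ⟨w, hw, h1⟩ := hstep 1 (one_mem _) (algebraMap V A a' * f₁)
            (mul_mem (hdC _ _) (le_adjoinElem hf₁)) (by rw [hF, map_mul]; ring)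
          exact hdu ⟨w, hw, h1.symm⟩
      · have hae : algebraMap K A e * algebraMap V A a = 1 := by
          rw [IsScalarTower.algebraMap_apply V K A, ha, ← map_mul, mul_inv_cancel₀ he, map_one]
        obtain ⟨y₂, hy₂, h'⟩ := hf₁reg δ hδ (D ^ n₂ * (D ^ n₁ * y))
            (mul_mem (pow_mem (hdC C _) _) hn₁)
            (algebraMap V A a * (D ^ n₁ * (D ^ n₂ * b)))
            (mul_mem (hdC C _) (mul_mem (pow_mem (hdC C _) _) hn₂)) (by
              rw [hF] at hyb
              linear_combination D ^ n₂ * D ^ n₁ * algebraMap V A a * hyb -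
                f₁ * D ^ n₁ * D ^ n₂ * y * hae)
        exact ⟨n₂ + n₁, y₂, hy₂, by rw [← h']; ring⟩
    obtain ⟨δ', rfl⟩ := hdiv m
    rw [map_mul, map_pow] at hm hyb
    have hδ' : algebraMap V A δ' ≠ 0 := hinj0 _ (right_ne_zero_of_mul hδ)
    have hy' : y = algebraMap V A δ' * y₂ :=
      mul_left_cancel₀ (pow_ne_zero m hdA) (by rw [hm]; ring)
    obtain ⟨y₃, hy₃, h3⟩ := hpow m y₂ (le_adjoinElem hy₂) b hb
      (mul_left_cancel₀ hδ' (by rw [hy'] at hyb; linear_combination hyb))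
    exact ⟨y₃, hy₃, by rw [hy', h3, map_mul, map_pow]; ring⟩
  · push Not at hdiv
    obtain ⟨n, hn⟩ := hdiv
    -- Here `δ * ε = d ^ n`, so multiplying by `ε` reduces to a power of `d`.
    obtain ⟨ε, hε⟩ := (ValuationRing.dvd_total δ (d ^ n)).resolve_right hn
    have hε0 : algebraMap V A ε ≠ 0 :=
      hinj0 _ (right_ne_zero_of_mul (hε ▸ pow_ne_zero n hd))
    have hεA : algebraMap V A d ^ n = algebraMap V A δ * algebraMap V A ε := by
      rw [← map_pow, hε, map_mul]
    obtain ⟨b', hb', h'⟩ := hpow n (algebraMap V A ε * y) (mul_mem (hdC _ _) hy) b hb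
      (by rw [hεA]; linear_combination algebraMap V A ε * hyb)
    exact ⟨b', hb', mul_left_cancel₀ hε0 (by rw [h', hεA]; ring)⟩

end

end PopescuVal

/-! ### Admissible subalgebras and the two ways of enlarging them. -/

namespace PopescuVal

set_option linter.unusedSectionVars false

open Polynomial

/-- The valuation `v` of `K'` restricts to `K` with valuation ring `V`, and makes `K'` an immediate
extension of `K`. -/
structure IsImmediateValuation (V : Type*) (K : Type*) {K' : Type*} [CommRing V] [Field K]
    [Field K'] [Algebra V K] [Algebra K K'] {Γ : Type*} [LinearOrderedCommGroupWithZero Γ]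
    (v : Valuation K' Γ) : Prop where
  le_one_iff : ∀ c : K, v (algebraMap K K' c) ≤ 1 ↔ ∃ a : V, algebraMap V K a = c
  exists_eq : ∀ y : K', ∃ c : K, v (algebraMap K K' c) = v y
  exists_sub_lt : ∀ y : K', y ≠ 0 → ∃ c : K, v (y - algebraMap K K' c) < v y

theorem algebraMap_injective_of_isFractionRing (V K A : Type*) [CommRing V] [Field K] [Algebra V K]
    [IsFractionRing V K] [CommRing A] [Nontrivial A] [Algebra V A] [Algebra K A]
    [IsScalarTower V K A] : Function.Injective (algebraMap V A) := by
  rw [IsScalarTower.algebraMap_eq V K A]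
  exact (algebraMap K A).injective.comp (IsFractionRing.injective V K)

variable {V : Type u} [CommRing V] [IsDomain V] [ValuationRing V] {K : Type w} [Field K]
  [Algebra V K] [IsFractionRing V K] {A : Type v} [CommRing A] [IsDomain A]
  [Algebra V A] [Algebra K A] [IsScalarTower V K A]
  {K' : Type*} [Field K'] [Algebra K K']
  {Γ : Type*} [LinearOrderedCommGroupWithZero Γ]

/-- `C` is a complete intersection over `V` which `ev` maps to the valuation ring of `v`, with the
kernel of `ev` on `C` generated by `f₀` up to `V`-torsion. -/
structure IsAdmissible (v : Valuation K' Γ) (ev : A →ₐ[K] K') (f₀ : A)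
    (C : Subalgebra V A) : Prop where
  le_one : ∀ y ∈ C, v (ev y) ≤ 1
  isCompleteIntersection : IsCompleteIntersectionAlgebra V C
  exists_mul_eq : ∀ y ∈ C, ev y = 0 → ∃ δ : V, δ ≠ 0 ∧ ∃ z ∈ C, algebraMap V A δ * y = f₀ * z

variable (K) in
/-- `f` is a constant times a unit of `C`. -/
def IsConstMulUnit (C : Subalgebra V A) (f : A) : Prop :=
  ∃ c : K, ∃ u ∈ C, ∃ u' ∈ C, u * u' = 1 ∧ f = algebraMap K A c * u

variable (K) in
/-- `f` is a constant times an element of `C` which is regular in the fibers. -/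
def IsConstMulRegular (C : Subalgebra V A) (f : A) : Prop :=
  ∃ c : K, ∃ g ∈ C, IsFiberRegular C g ∧ f = algebraMap K A c * g

variable {v : Valuation K' Γ} {ev : A →ₐ[K] K'} {f₀ : A} {C : Subalgebra V A} {z : A}

theorem IsConstMulUnit.mono {C' : Subalgebra V A} (h : C ≤ C') {f : A}
    (hf : IsConstMulUnit K C f) : IsConstMulUnit K C' f := by
  obtain ⟨c, u, hu, u', hu', h1, h2⟩ := hf
  exact ⟨c, u, h hu, u', h hu', h1, h2⟩

theorem map_le_one_of_mem_adjoinElem (hC : ∀ y ∈ C, v (ev y) ≤ 1) (hz : v (ev z) ≤ 1) :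
    ∀ y ∈ adjoinElem C z, v (ev y) ≤ 1 := fun y hy => by
  refine adjoinElem_induction (P := fun y => v (ev y) ≤ 1) ?_ ?_ hy
  · intro c hc n
    rw [map_mul, map_mul, map_pow, map_pow]
    exact mul_le_one' (hC c hc) (pow_le_one' hz n)
  · intro a b ha hb
    rw [map_add]
    exact v.map_add_le ha hb

theorem IsAdmissible.adjoinElem (hC : IsAdmissible v ev f₀ C) {d : V} {h : A} (hh : h ∈ C)
    (hd : d ≠ 0) (hz : algebraMap V A d * z = h) (hreg : IsFiberRegular C h)
    (hv : v (ev z) ≤ 1) : IsAdmissible v ev f₀ (adjoinElem C z) where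
  le_one := map_le_one_of_mem_adjoinElem hC.le_one hv
  isCompleteIntersection := by
    refine isCompleteIntersectionAlgebra_adjoinElem (d := ⟨_, C.algebraMap_mem d⟩) (h := ⟨h, hh⟩)
      hC.isCompleteIntersection ?_ hz ?_
    · intro h0
      apply hd
      apply algebraMap_injective_of_isFractionRing V K A
      rw [map_zero]
      exact congrArg Subtype.val h0
    · rintro ⟨y, hy⟩ ⟨⟨b, hb⟩, hyb⟩
      obtain ⟨b', hb', h'⟩ := hreg d hd y hy b hb (congrArg Subtype.val hyb)
      exact ⟨⟨b', hb'⟩, Subtype.ext h'⟩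
  exists_mul_eq := by
    intro y hy hy0
    obtain ⟨n, hn⟩ := exists_pow_mul_mem (C.algebraMap_mem d) hh hz hy
    obtain ⟨δ, hδ, x, hx, h'⟩ := hC.exists_mul_eq _ hn (by rw [map_mul, hy0, mul_zero])
    exact ⟨δ * d ^ n, mul_ne_zero hδ (pow_ne_zero n hd), x, le_adjoinElem hx, by
      rw [← h', map_mul, map_pow]; ring⟩

theorem IsAdmissible.adjoin_inv (hC : IsAdmissible v ev f₀ C) {t : A} (ht : t ∈ C)
    (htz : t * z = 1) (hv : v (ev t) = 1) : IsAdmissible v ev f₀ (PopescuVal.adjoinElem C z) where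
  le_one := by
    refine map_le_one_of_mem_adjoinElem hC.le_one ?_
    have := congrArg (fun a => v (ev a)) htz
    simp only [map_mul, map_one, hv, one_mul] at this
    exact this.le
  isCompleteIntersection := by
    refine isCompleteIntersectionAlgebra_adjoinElem (d := ⟨t, ht⟩) (h := 1)
      hC.isCompleteIntersection ?_ htz ?_
    · intro h0
      rw [show t = 0 from congrArg Subtype.val h0] at htz
      simp at htz
    · intro y hy
      rwa [one_mul] at hy
  exists_mul_eq := by
    intro y hy hy0
    obtain ⟨n, hn⟩ := exists_pow_mul_mem ht (one_mem C) htz hy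
    obtain ⟨δ, hδ, x, hx, h'⟩ := hC.exists_mul_eq _ hn (by rw [map_mul, hy0, mul_zero])
    refine ⟨δ, hδ, x * z ^ n, mul_mem (le_adjoinElem hx) (pow_mem self_mem_adjoinElem n), ?_⟩
    have h1 : t ^ n * z ^ n = 1 := by rw [← mul_pow, htz, one_pow]
    linear_combination z ^ n * h' - algebraMap V A δ * y * h1

/-- Equality of value groups supplies `d` with the value of `h`; adjoin `z = h/d`. An expansion in
`h` with coefficients constant times unit becomes one in `z`, and dividing by its largest constant
gives a polynomial over `C` with a unit coefficient. -/
theorem IsImmediateValuation.exists_adjoinElem [Algebra V K'] [IsScalarTower V K K']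
    (hv : IsImmediateValuation V K v)
    (hC : IsAdmissible v ev f₀ C) {h : A} (hh : h ∈ C) (hreg : IsFiberRegular C h)
    (hev : ev h ≠ 0) (S : Set A) (hS : ∀ f ∈ S, f ≠ 0 ∧ IsConstMulRegular K C f ∧
      ∃ (n : ℕ) (k : ℕ → K) (u : ℕ → A), (∀ i, u i ∈ C ∧ ∃ u' ∈ C, u i * u' = 1) ∧
        f = ∑ i ∈ Finset.range n, algebraMap K A (k i) * u i * h ^ i) :
    ∃ C₁ : Subalgebra V A, C ≤ C₁ ∧ IsAdmissible v ev f₀ C₁ ∧ (∃ z ∈ C₁, ∃ d : K,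
      algebraMap K A d * z = h ∧ v (algebraMap K K' d) = v (ev h)) ∧
      ∀ f ∈ S, IsConstMulRegular K C₁ f := by
  obtain ⟨c, hc⟩ := hv.exists_eq (ev h)
  obtain ⟨d, rfl⟩ := (hv.le_one_iff c).1 (hc.trans_le (hC.le_one h hh))
  have hvh : v (ev h) ≠ 0 := v.ne_zero_iff.2 hev
  have hdK : algebraMap V K d ≠ 0 := by
    intro h0
    rw [h0, map_zero, map_zero] at hc
    exact hvh hc.symm
  have hd : d ≠ 0 := by
    rintro rfl
    simp at hdK
  let z := algebraMap K A (algebraMap V K d)⁻¹ * h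
  have hz : algebraMap V A d * z = h := by
    rw [IsScalarTower.algebraMap_apply V K A, ← mul_assoc, ← map_mul, mul_inv_cancel₀ hdK,
      map_one, one_mul]
  have hz' : algebraMap K A (algebraMap V K d) * z = h := by
    rw [← hz, IsScalarTower.algebraMap_apply V K A]
  have hevz : v (ev z) = 1 := by
    have h1 := congrArg (fun a => v (ev a)) hz'
    simp only [map_mul, AlgHom.commutes, hc] at h1
    exact mul_left_cancel₀ hvh (by rw [h1, mul_one])
  -- For a unit `d` nothing is adjoined; the regularity argument needs `d` not invertible in `C[z]`.
  by_cases hu : IsUnit d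
  · obtain ⟨⟨d, d', hdd', _⟩, rfl⟩ := hu
    refine ⟨C, le_rfl, hC, ⟨z, ?_, _, hz', hc⟩, fun f hf => (hS f hf).2.1⟩
    have : z = algebraMap V A d' * h := by
      rw [← hz, ← mul_assoc, ← map_mul, mul_comm d', hdd', map_one, one_mul]
    rw [this]
    exact mul_mem (C.algebraMap_mem _) hh
  have hC₁ := hC.adjoinElem hh hd hz hreg hevz.le
  refine ⟨adjoinElem C z, le_adjoinElem, hC₁, ⟨z, self_mem_adjoinElem, _, hz', hc⟩, ?_⟩
  have hdu : ¬ ∃ w ∈ adjoinElem C z, algebraMap V A d * w = 1 := by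
    rintro ⟨w, hw, h1⟩
    apply hu
    have h2 := congrArg (fun a => v (ev a)) h1
    rw [IsScalarTower.algebraMap_apply V K A] at h2
    simp only [map_mul, AlgHom.commutes, map_one] at h2
    have h3 : v (algebraMap K K' (algebraMap V K d)⁻¹) ≤ 1 := by
      rw [map_inv₀, map_inv₀, inv_eq_of_mul_eq_one_right h2]
      exact hC₁.le_one w hw
    obtain ⟨d', hd'⟩ := (hv.le_one_iff _).1 h3
    refine IsUnit.of_mul_eq_one d' (IsFractionRing.injective V K ?_)
    rw [map_mul, hd', mul_inv_cancel₀ hdK, map_one]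
  intro f hf
  obtain ⟨hf0, ⟨c₁, f₁, hf₁, hf₁r, hff₁⟩, n, k, u, hu, hfs⟩ := hS f hf
  let γ : ℕ → K := fun i => k i * algebraMap V K d ^ i
  have hfγ : f = ∑ i ∈ Finset.range n, algebraMap K A (γ i) * u i * z ^ i := by
    rw [hfs]
    refine Finset.sum_congr rfl fun i _ => ?_
    rw [← hz', map_mul, map_pow]
    ring
  have hne : (Finset.range n).Nonempty := by
    rw [Finset.nonempty_iff_ne_empty]
    intro h0
    rw [h0, Finset.sum_empty] at hfγ
    exact hf0 hfγ
  obtain ⟨i₀, hi₀, hmax⟩ := Finset.exists_max_image (Finset.range n)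
    (fun i => v (algebraMap K K' (γ i))) hne
  have hγ0 : γ i₀ ≠ 0 := by
    intro h0
    apply hf0
    rw [hfγ]
    refine Finset.sum_eq_zero fun i hi => ?_
    have h1 := hmax i hi
    rw [h0, map_zero, map_zero, le_zero_iff, map_eq_zero, map_eq_zero] at h1
    rw [h1, map_zero, zero_mul, zero_mul]
  have hb : ∀ i, ∃ b : V, i ∈ Finset.range n → algebraMap V K b = γ i / γ i₀ := by
    intro i
    by_cases hi : i ∈ Finset.range n
    · obtain ⟨b, hb⟩ := (hv.le_one_iff (γ i / γ i₀)).1 (by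
        rw [map_div₀, map_div₀]
        exact div_le_one_of_le₀ (hmax i hi) zero_le)
      exact ⟨b, fun _ => hb⟩
    · exact ⟨0, fun h => absurd h hi⟩
  choose b hb using hb
  let F : C[X] := ∑ i ∈ Finset.range n, monomial i (b i • (⟨u i, (hu i).1⟩ : C))
  have hFc : F.coeff i₀ = b i₀ • (⟨u i₀, (hu i₀).1⟩ : C) := by
    simp only [F, finsetSum_coeff, coeff_monomial]
    rw [Finset.sum_ite_eq' (Finset.range n) i₀, if_pos hi₀]
  have hFu : IsUnit (F.coeff i₀) := by
    have hb1 : b i₀ = 1 := IsFractionRing.injective V K (by rw [hb i₀ hi₀, div_self hγ0, map_one])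
    rw [hFc, hb1, one_smul]
    obtain ⟨u', hu', h1⟩ := (hu i₀).2
    exact IsUnit.of_mul_eq_one ⟨u', hu'⟩ (Subtype.ext h1)
  have hFz : f = algebraMap K A (γ i₀) * aeval z F := by
    rw [hfγ, map_sum, Finset.mul_sum]
    refine Finset.sum_congr rfl fun i hi => ?_
    rw [aeval_monomial]
    change _ = algebraMap K A (γ i₀) * ((b i • u i) * z ^ i)
    rw [Algebra.smul_def, IsScalarTower.algebraMap_apply V K A, hb i hi, ← mul_assoc, ← mul_assoc,
      ← map_mul, mul_div_cancel₀ _ hγ0]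
  have hc₁ : c₁ ≠ 0 := by
    rintro rfl
    rw [map_zero, zero_mul] at hff₁
    exact hf0 hff₁
  refine ⟨γ i₀, aeval z F, mem_adjoinElem.2 ⟨F, rfl⟩,
    IsFiberRegular.adjoinElem hh hd hz hreg hdu hFu hf₁ hf₁r
      (mul_ne_zero (inv_ne_zero hγ0) hc₁) ?_, hFz⟩
  rw [map_mul, mul_assoc, ← hff₁, hFz, ← mul_assoc, ← map_mul, inv_mul_cancel₀ hγ0, map_one,
    one_mul]

end PopescuVal

/-! ### Ingredients of the induction: expansions, the initial algebra, inversion and small monic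
values. -/

namespace PopescuVal

set_option linter.unusedSectionVars false

open Polynomial

theorem exists_base_expansion {K : Type*} [Field K] {h : K[X]} (hm : h.Monic) {N : ℕ} (hN : 1 ≤ N)
    (hdeg : h.natDegree = N) (f : K[X]) :
    ∃ (n : ℕ) (a : ℕ → K[X]), (∀ i, (a i).natDegree < N) ∧
      f = ∑ i ∈ Finset.range n, a i * h ^ i := by
  induction hd : f.natDegree using Nat.strong_induction_on generalizing f with
  | _ m ih =>
    by_cases hlt : f.natDegree < N
    · exact ⟨1, fun i => if i = 0 then f else 0, fun i => by
        dsimp only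
        split_ifs
        · exact hlt
        · rwa [natDegree_zero], by simp⟩
    · obtain ⟨n, a, ha, hf⟩ := ih (f /ₘ h).natDegree (by rw [natDegree_divByMonic _ hm]; omega)
        (f /ₘ h) rfl
      refine ⟨n + 1, fun i => if i = 0 then f %ₘ h else a (i - 1), fun i => ?_, ?_⟩
      · dsimp only
        split_ifs
        · rw [← hdeg]
          exact natDegree_modByMonic_lt f hm (by
            rintro rfl
            simp at hdeg
            omega)
        · exact ha _
      · rw [Finset.sum_range_succ']
        simp only [Nat.add_eq_zero_iff, one_ne_zero, and_false, if_false, if_true,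
          Nat.add_sub_cancel, pow_zero, mul_one]
        conv_lhs => rw [← modByMonic_add_div f h, hf, Finset.mul_sum]
        rw [add_comm]
        congr 1
        refine Finset.sum_congr rfl fun i _ => ?_
        ring

variable {V : Type u} [CommRing V] [IsDomain V] [ValuationRing V] {K : Type w} [Field K]
  [Algebra V K] [IsFractionRing V K] {A : Type v} [CommRing A] [IsDomain A]
  [Algebra V A] [Algebra K A] [IsScalarTower V K A]
  {K' : Type*} [Field K'] [Algebra K K'] [Algebra V K'] [IsScalarTower V K K']
  {Γ : Type*} [LinearOrderedCommGroupWithZero Γ]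
  {v : Valuation K' Γ} {ev : A →ₐ[K] K'} {f₀ : A} {C : Subalgebra V A} {z : A}

/-- Divide by a coefficient of largest value. -/
theorem IsImmediateValuation.exists_primitive (hv : IsImmediateValuation V K v) {f : K[X]}
    (hf : f ≠ 0) : ∃ (c : K) (g : V[X]) (i : ℕ), g.coeff i = 1 ∧
      f = Polynomial.C c * g.map (algebraMap V K) := by
  obtain ⟨i₀, hi₀, hmax⟩ := Finset.exists_max_image f.support
    (fun i => v (algebraMap K K' (f.coeff i))) (by simpa using hf)
  have hc : f.coeff i₀ ≠ 0 := by simpa using hi₀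
  have hlift : Polynomial.C (f.coeff i₀)⁻¹ * f ∈ Polynomial.lifts (algebraMap V K) := by
    rw [Polynomial.lifts_iff_coeff_lifts]
    intro i
    rw [coeff_C_mul]
    obtain ⟨a, ha⟩ := (hv.le_one_iff ((f.coeff i₀)⁻¹ * f.coeff i)).1 (by
      by_cases hi : i ∈ f.support
      · rw [inv_mul_eq_div, map_div₀, map_div₀]
        exact div_le_one_of_le₀ (hmax i hi) zero_le
      · rw [notMem_support_iff.1 hi]
        simp)
    exact ⟨a, ha⟩
  obtain ⟨g, hg⟩ := (Polynomial.mem_lifts _).1 hlift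
  refine ⟨f.coeff i₀, g, i₀, ?_, ?_⟩
  · apply IsFractionRing.injective V K
    rw [← coeff_map, hg, coeff_C_mul, inv_mul_cancel₀ hc, map_one]
  · rw [hg, ← mul_assoc, ← map_mul, mul_inv_cancel₀ hc, map_one, one_mul]

theorem aeval_injective_of_isFractionRing {ξ : A} (hξ : Function.Injective (aeval ξ : K[X] →ₐ[K] A)) :
    Function.Injective (aeval ξ : V[X] →ₐ[V] A) := by
  intro p q hpq
  rw [← aeval_map_algebraMap K ξ p, ← aeval_map_algebraMap K ξ q] at hpq
  exact Polynomial.map_injective _ (IsFractionRing.injective V K) (hξ hpq)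

/-- The kernel condition is divisibility by the minimal polynomial over `K` with denominators
cleared. For transcendental `ev ξ`, `minpoly` is zero and the same argument applies. -/
theorem isAdmissible_range_aeval (hv : IsImmediateValuation V K v) {ξ : A}
    (hξ : Function.Injective (aeval ξ : K[X] →ₐ[K] A)) (hx : v (ev ξ) ≤ 1) :
    IsAdmissible v ev (aeval ξ (minpoly K (ev ξ))) (aeval ξ : V[X] →ₐ[V] A).range where
  le_one := by
    rintro _ ⟨p, rfl⟩
    change v (ev (aeval ξ p)) ≤ 1
    induction p using Polynomial.induction_on' with
    | add p q hp hq => rw [map_add, map_add]; exact v.map_add_le hp hq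
    | monomial n a =>
      rw [aeval_monomial, IsScalarTower.algebraMap_apply V K A, map_mul, map_mul, map_pow, map_pow,
        AlgHom.commutes]
      exact mul_le_one' ((hv.le_one_iff _).2 ⟨a, rfl⟩) (pow_le_one' hx n)
  isCompleteIntersection :=
    (IsCompleteIntersectionAlgebra.self V).polynomial.of_algEquiv
      (AlgEquiv.ofInjective _ (aeval_injective_of_isFractionRing hξ))
  exists_mul_eq := by
    rintro _ ⟨p, rfl⟩ hp
    change ev (aeval ξ p) = 0 at hp
    change ∃ δ : V, δ ≠ 0 ∧ ∃ z ∈ _, algebraMap V A δ * aeval ξ p = _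
    rw [← aeval_map_algebraMap K, ← aeval_algHom_apply] at hp
    obtain ⟨q, hq⟩ := minpoly.dvd K (ev ξ) hp
    obtain ⟨δ, hδ0, hδ⟩ := IsLocalization.integerNormalization_spec (nonZeroDivisors V) q
    refine ⟨δ, nonZeroDivisors.ne_zero hδ0, _,
      ⟨IsLocalization.integerNormalization (nonZeroDivisors V) q, rfl⟩, ?_⟩
    change _ = _ * aeval ξ (IsLocalization.integerNormalization (nonZeroDivisors V) q)
    rw [← aeval_map_algebraMap K ξ p,
      ← aeval_map_algebraMap K ξ (IsLocalization.integerNormalization _ q), hδ, hq, map_mul, ← algebraMap_smul K, map_smul, Algebra.smul_def, IsScalarTower.algebraMap_apply V K A]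
    ring

theorem isFiberRegular_aeval {ξ : A} (hξ : Function.Injective (aeval ξ : K[X] →ₐ[K] A))
    {g : V[X]} {i : ℕ} (hg : g.coeff i = 1) :
    IsFiberRegular (aeval ξ : V[X] →ₐ[V] A).range (aeval ξ g) := by
  rintro δ hδ _ ⟨p, rfl⟩ _ ⟨q, rfl⟩ h
  change aeval ξ g * aeval ξ p = _ * aeval ξ q at h
  have h1 : g * p = Polynomial.C δ * q := by
    apply aeval_injective_of_isFractionRing hξ
    rw [map_mul, map_mul, aeval_C, h]
  have hmap : (Ideal.span {δ}).map (Polynomial.C : V →+* V[X]) = Ideal.span {Polynomial.C δ} := by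
    rw [Ideal.map_span, Set.image_singleton]
  have h2 : p ∈ (Ideal.span {δ}).map (Polynomial.C : V →+* V[X]) := by
    apply mem_map_C_of_mul_mem (g := g) (i := i) (by rw [hg]; exact isUnit_one)
    rw [hmap, Ideal.mem_span_singleton]
    exact ⟨q, h1⟩
  rw [hmap, Ideal.mem_span_singleton] at h2
  obtain ⟨r, rfl⟩ := h2
  refine ⟨_, ⟨r, rfl⟩, ?_⟩
  change aeval ξ (Polynomial.C δ * r) = _ * aeval ξ r
  rw [map_mul, aeval_C]

/-- Inverting the product of the elements, again of value one, inverts them all in one step. -/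
theorem IsAdmissible.exists_inverses (hunit : ∀ a : A, ev a ≠ 0 → IsUnit a)
    (hC : IsAdmissible v ev f₀ C) (T : Finset A) (hT : ∀ t ∈ T, t ∈ C ∧ v (ev t) = 1) :
    ∃ C' : Subalgebra V A, C ≤ C' ∧ IsAdmissible v ev f₀ C' ∧
      (∀ t ∈ T, ∃ t' ∈ C', t * t' = 1) ∧
      ∀ f, IsConstMulRegular K C f → IsConstMulRegular K C' f := by
  classical
  have hP : v (ev (∏ t ∈ T, t)) = 1 := by
    rw [map_prod, map_prod]
    exact Finset.prod_eq_one fun t ht => (hT t ht).2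
  have hPC : ∏ t ∈ T, t ∈ C := prod_mem fun t ht => (hT t ht).1
  obtain ⟨z, hz⟩ := (hunit (∏ t ∈ T, t) (fun h0 => by
    rw [h0, map_zero] at hP
    exact zero_ne_one hP)).exists_right_inv
  refine ⟨PopescuVal.adjoinElem C z, le_adjoinElem, hC.adjoin_inv hPC hz hP, fun t ht => ?_, ?_⟩
  · refine ⟨(∏ s ∈ T.erase t, s) * z, mul_mem (le_adjoinElem ?_) self_mem_adjoinElem, ?_⟩
    · exact prod_mem fun s hs => (hT s (Finset.mem_of_mem_erase hs)).1
    · rw [← mul_assoc, Finset.mul_prod_erase T (fun t => t) ht, hz]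
  · rintro f ⟨c, g, hg, hr, hf⟩
    exact ⟨c, g, le_adjoinElem hg, hr.adjoin_inv hPC hz, hf⟩

/-- The values at `x` of monic polynomials of degree `N` have no minimum: immediacy gives a constant
whose subtraction lowers the value, and `N ≥ 1` keeps the polynomial monic. Each `f` divided by its
leading coefficient is itself such a polynomial, so one `h` can lie strictly below all of them. -/
theorem IsImmediateValuation.exists_monic_lt (hv : IsImmediateValuation V K v) {x : K'} {N : ℕ}
    (hN : 1 ≤ N) (hx : ∀ f : K[X], f ≠ 0 → f.natDegree < N + 1 → aeval x f ≠ 0)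
    {F : Set K[X]} (hF : F.Finite) : ∃ h : K[X], h.Monic ∧ h.natDegree = N ∧
      ∀ f ∈ F, f ≠ 0 → f.natDegree = N →
        v (algebraMap K K' f.leadingCoeff * aeval x h) < v (aeval x f) := by
  have hsub : ∀ h : K[X], h.Monic → h.natDegree = N →
      ∃ h' : K[X], h'.Monic ∧ h'.natDegree = N ∧ v (aeval x h') < v (aeval x h) := by
    intro h hm hd
    obtain ⟨c, hc⟩ := hv.exists_sub_lt (aeval x h) (hx h hm.ne_zero (by omega))
    have hlt : (Polynomial.C c).degree < h.degree := by
      rw [degree_eq_natDegree hm.ne_zero, hd]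
      exact degree_C_le.trans_lt (by exact_mod_cast hN)
    refine ⟨h - Polynomial.C c, hm.sub_of_left hlt, ?_, ?_⟩
    · rw [natDegree_sub_C, hd]
    · rwa [map_sub, aeval_C]
  induction F, hF using Set.Finite.induction_on with
  | empty => exact ⟨X ^ N, monic_X_pow N, natDegree_X_pow N, by simp⟩
  | insert _ _ ih =>
    rename_i f F _ _
    obtain ⟨h, hm, hd, hh⟩ := ih
    by_cases hf : f ≠ 0 ∧ f.natDegree = N
    · have hlc : f.leadingCoeff ≠ 0 := leadingCoeff_ne_zero.2 hf.1
      have hlc' : 0 < v (algebraMap K K' f.leadingCoeff) := by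
        rw [zero_lt_iff]
        simpa using hf.1
      have hf1m : (Polynomial.C f.leadingCoeff⁻¹ * f).Monic := by
        rw [mul_comm]
        exact monic_mul_leadingCoeff_inv hf.1
      have hf1d : (Polynomial.C f.leadingCoeff⁻¹ * f).natDegree = N := by
        rw [natDegree_C_mul (inv_ne_zero hlc), hf.2]
      have hff : v (aeval x f) = v (algebraMap K K' f.leadingCoeff) *
          v (aeval x (Polynomial.C f.leadingCoeff⁻¹ * f)) := by
        rw [← map_mul, map_mul (aeval x), aeval_C, ← mul_assoc, ← map_mul, mul_inv_cancel₀ hlc,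
          map_one, one_mul]
      obtain ⟨h', hm', hd', h1, h2⟩ : ∃ h' : K[X], h'.Monic ∧ h'.natDegree = N ∧
          v (aeval x h') ≤ v (aeval x h) ∧
          v (aeval x h') < v (aeval x (Polynomial.C f.leadingCoeff⁻¹ * f)) := by
        rcases le_total (v (aeval x h)) (v (aeval x (Polynomial.C f.leadingCoeff⁻¹ * f)))
          with hle | hle
        · obtain ⟨h', h1, h2, h3⟩ := hsub h hm hd
          exact ⟨h', h1, h2, h3.le, h3.trans_le hle⟩
        · obtain ⟨h', h1, h2, h3⟩ := hsub _ hf1m hf1d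
          exact ⟨h', h1, h2, (h3.trans_le hle).le, h3⟩
      refine ⟨h', hm', hd', ?_⟩
      rintro g (rfl | hg) hg0 hgN
      · rw [map_mul, hff]
        exact mul_lt_mul_of_pos_left h2 hlc'
      · refine lt_of_le_of_lt ?_ (hh g hg hg0 hgN)
        rw [map_mul, map_mul]
        exact mul_le_mul_right h1 _
    · refine ⟨h, hm, hd, ?_⟩
      rintro g (rfl | hg) hg0 hgN
      · exact absurd ⟨hg0, hgN⟩ hf
      · exact hh g hg hg0 hgN

end PopescuVal

/-! ### The induction on the degree, and its consequence in `K'`. -/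

namespace PopescuVal

set_option linter.unusedSectionVars false

open Polynomial

variable {V : Type u} [CommRing V] [IsDomain V] [ValuationRing V] {K : Type w} [Field K]
  [Algebra V K] [IsFractionRing V K] {A : Type v} [CommRing A] [IsDomain A]
  [Algebra V A] [Algebra K A] [IsScalarTower V K A]
  {K' : Type*} [Field K'] [Algebra K K'] [Algebra V K'] [IsScalarTower V K K']
  {Γ : Type*} [LinearOrderedCommGroupWithZero Γ]
  {v : Valuation K' Γ} {ev : A →ₐ[K] K'} {f₀ : A} {C : Subalgebra V A} {z : A}

theorem IsAdmissible.map_eq_one (hC : IsAdmissible v ev f₀ C) {u u' : A} (hu : u ∈ C)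
    (hu' : u' ∈ C) (h : u * u' = 1) : v (ev u) = 1 := by
  refine le_antisymm (hC.le_one u hu) ?_
  have h1 := congrArg (fun a => v (ev a)) h
  simp only [map_mul, map_one] at h1
  rw [← h1]
  exact mul_le_of_le_one_right' (hC.le_one u' hu')

/-- Polynomials of degree less than `N` become constants times units, and all polynomials become
constants times elements regular in the fibers, on a suitable admissible subalgebra. -/
theorem IsImmediateValuation.exists_isAdmissible (hv : IsImmediateValuation V K v) {ξ : A}
    (hξ : Function.Injective (aeval ξ : K[X] →ₐ[K] A)) (hunit : ∀ a : A, ev a ≠ 0 → IsUnit a)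
    (hx : v (ev ξ) ≤ 1) {N : ℕ} (hN : 1 ≤ N)
    (hne : ∀ f : K[X], f ≠ 0 → f.natDegree < N → aeval (ev ξ) f ≠ 0)
    {F : Set K[X]} (hF : F.Finite) :
    ∃ C : Subalgebra V A, IsAdmissible v ev (aeval ξ (minpoly K (ev ξ))) C ∧
      (∀ f ∈ F, f ≠ 0 → f.natDegree < N → IsConstMulUnit K C (aeval ξ f)) ∧
      ∀ f ∈ F, f ≠ 0 → IsConstMulRegular K C (aeval ξ f) := by
  induction N, hN using Nat.le_induction generalizing F with
  | base =>
    refine ⟨_, isAdmissible_range_aeval hv hξ hx, fun f hf hf0 hd => ?_, fun f hf hf0 => ?_⟩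
    · refine ⟨f.coeff 0, 1, one_mem _, 1, one_mem _, one_mul 1, ?_⟩
      rw [eq_C_of_natDegree_le_zero (Nat.lt_one_iff.1 hd).le, aeval_C, mul_one, coeff_C_zero]
    · obtain ⟨c, g, i, hg, rfl⟩ := hv.exists_primitive hf0
      refine ⟨c, aeval ξ g, ⟨g, rfl⟩, isFiberRegular_aeval hξ hg, ?_⟩
      rw [map_mul, aeval_C, aeval_map_algebraMap]
  | succ N hN ih =>
    obtain ⟨h, hm, hd, hlt⟩ := hv.exists_monic_lt hN hne hF
    choose n a ha hfa using exists_base_expansion hm hN hd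
    -- The induction hypothesis must also control `h`, the digits of each `f` in base `h`, and the
    -- remainders `f - lc(f) h`, whose degree is below `N` when `f` has degree `N`.
    let F₁ : Set K[X] := F ∪ {h} ∪ (⋃ f ∈ F, a f '' (Finset.range (n f) : Set ℕ)) ∪
      (fun f => f - Polynomial.C f.leadingCoeff * h) '' F
    have hF₁ : F₁.Finite := ((hF.union (Set.finite_singleton h)).union
      (hF.biUnion fun f _ => (Finset.finite_toSet _).image _)).union (hF.image _)
    obtain ⟨C, hC, hCu, hCr⟩ := ih (fun f hf hfd => hne f hf (by omega)) hF₁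
    have hFF₁ : ∀ f ∈ F, f ∈ F₁ := fun f hf => Or.inl (Or.inl (Or.inl hf))
    have hhF₁ : h ∈ F₁ := Or.inl (Or.inl (Or.inr rfl))
    have haF₁ : ∀ f ∈ F, ∀ i < n f, a f i ∈ F₁ := fun f hf i hi =>
      Or.inl (Or.inr (Set.mem_biUnion hf ⟨i, by simpa using hi, rfl⟩))
    have hgF₁ : ∀ f ∈ F, f - Polynomial.C f.leadingCoeff * h ∈ F₁ := fun f hf => Or.inr ⟨f, hf, rfl⟩
    have hevξ : ∀ p : K[X], ev (aeval ξ p) = aeval (ev ξ) p := fun p =>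
      (aeval_algHom_apply ev ξ p).symm
    obtain ⟨c, h', hh', hh'r, hch'⟩ := hCr h hhF₁ hm.ne_zero
    have hevh : ev (aeval ξ h) ≠ 0 := by
      rw [hevξ]
      exact hne h hm.ne_zero (by omega)
    have hevh' : ev h' ≠ 0 := by
      intro h0
      rw [hch', map_mul, h0, mul_zero] at hevh
      exact hevh rfl
    obtain ⟨C₁, hCC₁, hC₁, ⟨z, hz, d, hdz, hdv⟩, hC₁r⟩ := hv.exists_adjoinElem hC hh' hh'r hevh'
      ((fun f => aeval ξ f) '' {f | f ∈ F ∧ f ≠ 0}) (by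
        rintro _ ⟨f, ⟨hf, hf0⟩, rfl⟩
        refine ⟨fun h0 => hf0 (hξ (by rw [map_zero]; exact h0)), hCr f (hFF₁ f hf) hf0, n f, ?_⟩
        have hex : ∀ i, ∃ (k : K) (u : A), (u ∈ C ∧ ∃ u' ∈ C, u * u' = 1) ∧
            (i < n f → aeval ξ (a f i) = algebraMap K A k * u) := by
          intro i
          by_cases hi : i < n f ∧ a f i ≠ 0
          · obtain ⟨k, u, hu, u', hu', h1, h2⟩ := hCu _ (haF₁ f hf i hi.1) hi.2 (ha f i)
            exact ⟨k, u, ⟨hu, u', hu', h1⟩, fun _ => h2⟩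
          · refine ⟨0, 1, ⟨one_mem _, 1, one_mem _, one_mul 1⟩, fun hi' => ?_⟩
            have : a f i = 0 := by
              by_contra h0
              exact hi ⟨hi', h0⟩
            rw [this, map_zero, map_zero, zero_mul]
        choose k u hu hk using hex
        refine ⟨fun i => k i * c ^ i, u, hu, ?_⟩
        dsimp only
        conv_lhs => rw [hfa f]
        rw [map_sum]
        refine Finset.sum_congr rfl fun i hi => ?_
        rw [map_mul, map_pow, hk i (Finset.mem_range.1 hi), hch', map_mul, map_pow]
        ring)
    -- The remainder `g` has the same value as `f` at `x` and equals `k * u` with `u` a unit. The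
    -- term `lc(f) h` has smaller value, so it is `k * b * z` with `b` in `V`, and `t = u + b z` has
    -- value one.
    have hN1 : ∀ f ∈ F, f ≠ 0 → f.natDegree = N → ∃ k : K, ∃ t ∈ C₁, v (ev t) = 1 ∧
        aeval ξ f = algebraMap K A k * t := by
      intro f hf hf0 hfN
      have hfl := hlt f hf hf0 hfN
      set g := f - Polynomial.C f.leadingCoeff * h with hg
      have hvg : v (aeval (ev ξ) g) = v (aeval (ev ξ) f) := by
        rw [hg, map_sub, map_mul, aeval_C]
        exact Valuation.map_sub_eq_of_lt_left v hfl
      have hvf : v (aeval (ev ξ) f) ≠ 0 := ((zero_le).trans_lt hfl).ne'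
      have hg0 : g ≠ 0 := by
        intro h0
        rw [h0, map_zero, map_zero] at hvg
        exact hvf hvg.symm
      have hgd : g.natDegree < N := by
        have hlc : f.leadingCoeff ≠ 0 := leadingCoeff_ne_zero.2 hf0
        have hdeg : f.degree = (Polynomial.C f.leadingCoeff * h).degree := by
          rw [degree_C_mul hlc, degree_eq_natDegree hf0, degree_eq_natDegree hm.ne_zero, hfN, hd]
        have := degree_sub_lt_left hdeg hf0 (by
          rw [leadingCoeff_mul, leadingCoeff_C, hm.leadingCoeff, mul_one])
        rw [← hg, degree_eq_natDegree hf0, hfN, degree_eq_natDegree hg0] at this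
        exact_mod_cast this
      obtain ⟨k, u, hu, u', hu', h1, h2⟩ := hCu g (hgF₁ f hf) hg0 hgd
      have hvk : v (algebraMap K K' k) = v (aeval (ev ξ) f) := by
        rw [← hvg, ← hevξ, h2, map_mul, AlgHom.commutes, map_mul, hC.map_eq_one hu hu' h1, mul_one]
      have hk0 : k ≠ 0 := by
        rintro rfl
        rw [map_zero, map_zero] at hvk
        exact hvf hvk.symm
      obtain ⟨b, hb⟩ := (hv.le_one_iff (f.leadingCoeff * c * d / k)).1 (by
        rw [map_div₀, map_div₀, hvk]
        refine div_le_one_of_le₀ ?_ zero_le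
        rw [map_mul, map_mul, hdv, map_mul, map_mul, mul_assoc]
        rw [map_mul, ← hevξ, hch', map_mul, map_mul, AlgHom.commutes] at hfl
        exact hfl.le)
      have hft : aeval ξ f = algebraMap K A k * (u + algebraMap V A b * z) := by
        have hfg : aeval ξ f = aeval ξ g + algebraMap K A f.leadingCoeff * aeval ξ h := by
          rw [hg, map_sub, map_mul, aeval_C]
          ring
        rw [hfg, h2, hch', ← hdz,
          IsScalarTower.algebraMap_apply V K A, hb, mul_add, ← mul_assoc (algebraMap K A k),
          ← map_mul, mul_div_cancel₀ _ hk0, map_mul, map_mul]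
        ring
      refine ⟨k, u + algebraMap V A b * z,
        add_mem (hCC₁ hu) (mul_mem (C₁.algebraMap_mem b) hz), ?_, hft⟩
      rw [← hevξ, hft, map_mul, AlgHom.commutes, map_mul] at hvk
      exact mul_left_cancel₀ (by simpa using hk0 : v (algebraMap K K' k) ≠ 0)
        (by rw [← hvk, mul_one])
    have hex : ∀ f, ∃ t, f ∈ F → f ≠ 0 → f.natDegree = N → t ∈ C₁ ∧ v (ev t) = 1 ∧
        ∃ k, aeval ξ f = algebraMap K A k * t := by
      intro f
      by_cases hf : f ∈ F ∧ f ≠ 0 ∧ f.natDegree = N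
      · obtain ⟨k, t, h1, h2, h3⟩ := hN1 f hf.1 hf.2.1 hf.2.2
        exact ⟨t, fun _ _ _ => ⟨h1, h2, k, h3⟩⟩
      · exact ⟨0, fun h1 h2 h3 => absurd ⟨h1, h2, h3⟩ hf⟩
    choose t ht using hex
    have hT : (t '' {f | f ∈ F ∧ f ≠ 0 ∧ f.natDegree = N}).Finite :=
      (hF.subset fun f hf => hf.1).image t
    obtain ⟨C₂, hC₁C₂, hC₂, hinv, hC₂r⟩ := hC₁.exists_inverses (K := K) hunit hT.toFinset (by
      intro s hs
      obtain ⟨f, hf, rfl⟩ := hT.mem_toFinset.1 hs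
      exact ⟨(ht f hf.1 hf.2.1 hf.2.2).1, (ht f hf.1 hf.2.1 hf.2.2).2.1⟩)
    refine ⟨C₂, hC₂, fun f hf hf0 hfd => ?_, fun f hf hf0 => hC₂r _ (hC₁r _ ⟨f, ⟨hf, hf0⟩, rfl⟩)⟩
    rcases Nat.lt_succ_iff_lt_or_eq.1 hfd with hfd | hfd
    · exact (hCu f (hFF₁ f hf) hf0 hfd).mono (hCC₁.trans hC₁C₂)
    · obtain ⟨h1, h2, k, h3⟩ := ht f hf hf0 hfd
      obtain ⟨t', ht', htt'⟩ := hinv (t f) (hT.mem_toFinset.2 ⟨f, ⟨hf, hf0, hfd⟩, rfl⟩)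
      exact ⟨k, t f, hC₁C₂ h1, t', ht', htt', h3⟩

variable (v) in
/-- Every finite subset of the valuation ring of `v` is contained in a complete intersection. -/
theorem IsImmediateValuation.exists_subalgebra (hv : IsImmediateValuation V K v) {ξ : A}
    (hξ : Function.Injective (aeval ξ : K[X] →ₐ[K] A)) (hunit : ∀ a : A, ev a ≠ 0 → IsUnit a)
    (hx : v (ev ξ) ≤ 1) (htop : IntermediateField.adjoin K {ev ξ} = ⊤)
    {E : Set K'} (hE : E.Finite) (hE1 : ∀ y ∈ E, v y ≤ 1) :
    ∃ D : Subalgebra V K', IsCompleteIntersectionAlgebra V D ∧ (∀ y ∈ E, y ∈ D) ∧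
      ∀ y ∈ D, v y ≤ 1 := by
  have hevξ : ∀ p : K[X], ev (aeval ξ p) = aeval (ev ξ) p := fun p =>
      (aeval_algHom_apply ev ξ p).symm
  have hker : ∀ C : Subalgebra V A, Nonempty ((C ⧸ RingHom.ker
      ((ev.restrictScalars V).comp C.val)) ≃ₐ[V] C.map (ev.restrictScalars V)) := fun C => by
    refine ⟨(Ideal.quotientKerEquivRange _).trans (Subalgebra.equivOfEq _ _ ?_)⟩
    rw [AlgHom.range_comp, Subalgebra.range_val]
  have hle : ∀ C : Subalgebra V A, IsAdmissible v ev (aeval ξ (minpoly K (ev ξ))) C →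
      ∀ y ∈ C.map (ev.restrictScalars V), v y ≤ 1 := by
    rintro C hC _ ⟨y, hy, rfl⟩
    exact hC.le_one y hy
  have hmem : ∀ (C : Subalgebra V A) (k : K) (u : A), u ∈ C → v (algebraMap K K' k) ≤ 1 →
      algebraMap K K' k * ev u ∈ C.map (ev.restrictScalars V) := by
    intro C k u hu hk
    obtain ⟨b, rfl⟩ := (hv.le_one_iff k).1 hk
    refine ⟨algebraMap V A b * u, mul_mem (C.algebraMap_mem b) hu, ?_⟩
    change ev _ = _
    rw [map_mul, IsScalarTower.algebraMap_apply V K A, AlgHom.commutes]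
  by_cases hint : IsIntegral K (ev ξ)
  · have hpos := minpoly.natDegree_pos hint
    have hp : ∀ y : K', ∃ p : K[X], aeval (ev ξ) p = y ∧
        p.natDegree < (minpoly K (ev ξ)).natDegree := by
      intro y
      have hy : y ∈ (IntermediateField.adjoin K {ev ξ}).toSubalgebra := by
        rw [htop]; trivial
      rw [IntermediateField.adjoin_simple_toSubalgebra_of_isAlgebraic hint.isAlgebraic,
        Algebra.adjoin_singleton_eq_range_aeval] at hy
      obtain ⟨p, rfl⟩ := hy
      refine ⟨p %ₘ minpoly K (ev ξ), ?_, natDegree_modByMonic_lt p (minpoly.monic hint)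
        (minpoly.ne_one _ _)⟩
      exact aeval_modByMonic_eq_self_of_root (minpoly.aeval _ _)
    choose p hpy hpd using hp
    -- Take `N` to be the degree of the minimal polynomial: below it no nonzero polynomial vanishes
    -- at `ev ξ`, yet all of `K'` is represented. The minimal polynomial joins the set so that it
    -- becomes fiber regular.
    obtain ⟨C, hC, hCu, hCr⟩ := hv.exists_isAdmissible hξ hunit hx hpos
      (fun f hf hfd h0 => absurd (natDegree_le_natDegree (minpoly.degree_le_of_ne_zero K (ev ξ) hf h0)) (by omega))
      ((hE.image p).insert (minpoly K (ev ξ)))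
    refine ⟨C.map (ev.restrictScalars V), ?_, fun y hy => ?_, hle C hC⟩
    · obtain ⟨c, g, hg, hgr, hcg⟩ := hCr _ (Set.mem_insert _ _) (minpoly.ne_zero hint)
      have hmin0 : aeval ξ (minpoly K (ev ξ)) ≠ 0 := fun h0 =>
        minpoly.ne_zero hint (hξ (by rw [h0, map_zero]))
      have hg0 : g ≠ 0 := by
        rintro rfl
        rw [mul_zero] at hcg
        exact hmin0 hcg
      have hc0 : c ≠ 0 := by
        rintro rfl
        rw [map_zero, zero_mul] at hcg
        exact hmin0 hcg
      have hevg : ev g = 0 := by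
        have h1 := congrArg ev hcg
        rw [hevξ, minpoly.aeval, map_mul, AlgHom.commutes, eq_comm, mul_eq_zero] at h1
        exact h1.resolve_left (by simpa using hc0)
      obtain ⟨e⟩ := hker C
      have hspan : Ideal.span {(⟨g, hg⟩ : C)} =
          RingHom.ker ((ev.restrictScalars V).comp C.val) := by
        ext ⟨y, hy⟩
        rw [Ideal.mem_span_singleton, RingHom.mem_ker]
        constructor
        · rintro ⟨w, hw⟩
          change ev y = 0
          rw [show y = g * w from congrArg Subtype.val hw, map_mul, hevg, zero_mul]
        · intro hy0
          obtain ⟨δ, hδ, w, hw, hyw⟩ := hC.exists_mul_eq y hy hy0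
          -- With `c = a / b`, the torsion relation reads `g * (a * w) = b * δ * y`; regularity of
          -- `g` modulo `b * δ` lets that constant be cancelled.
          obtain ⟨a, b, hb, hab⟩ := IsFractionRing.div_surjective V c
          have hb0 : b ≠ 0 := nonZeroDivisors.ne_zero hb
          have hbK : algebraMap V K b ≠ 0 := by
            simpa using hb0
          have hcb : algebraMap V A b * algebraMap K A c = algebraMap V A a := by
            rw [IsScalarTower.algebraMap_apply V K A, IsScalarTower.algebraMap_apply V K A,
              ← map_mul, ← hab, mul_div_cancel₀ _ hbK]
          obtain ⟨w', hw', h1⟩ := hgr (b * δ) (mul_ne_zero hb0 hδ) (algebraMap V A a * w)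
            (mul_mem (C.algebraMap_mem a) hw) y hy (by
              rw [hcg] at hyw
              rw [map_mul, ← hcb]
              linear_combination -algebraMap V A b * hyw)
          refine ⟨⟨w', hw'⟩, Subtype.ext ?_⟩
          change y = g * w'
          have hbδ : algebraMap V A (b * δ) ≠ 0 := by
            rw [Ne, map_eq_zero_iff _ (algebraMap_injective_of_isFractionRing V K A)]
            exact mul_ne_zero hb0 hδ
          apply mul_left_cancel₀ hbδ
          rw [hcg] at hyw
          rw [← hcb] at h1
          rw [map_mul] at h1 ⊢
          linear_combination algebraMap V A b * hyw + g * h1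
      refine (hC.isCompleteIntersection.quotient (a := ⟨g, hg⟩) (fun b hb =>
        (mul_eq_zero.1 hb).resolve_left fun h0 => hg0 (congrArg Subtype.val h0)) ?_).of_algEquiv
        ((Ideal.quotientEquivAlgOfEq V hspan).trans e)
      intro hu
      rw [← Ideal.span_singleton_eq_top, hspan] at hu
      exact RingHom.ker_ne_top _ hu
    · by_cases hy0 : y = 0
      · rw [hy0]
        exact zero_mem _
      have hp0 : p y ≠ 0 := by
        intro h0
        apply hy0
        rw [← hpy y, h0, map_zero]
      obtain ⟨k, u, hu, u', hu', h1, h2⟩ := hCu (p y)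
        (Set.mem_insert_of_mem _ ⟨y, hy, rfl⟩) hp0 (hpd y)
      have h3 : y = algebraMap K K' k * ev u := by
        rw [← hpy y, ← hevξ, h2, map_mul, AlgHom.commutes]
      have h4 := hE1 y hy
      rw [h3, map_mul, hC.map_eq_one hu hu' h1, mul_one] at h4
      rw [h3]
      exact hmem C k u hu h4
  · have hmin : minpoly K (ev ξ) = 0 := minpoly.eq_zero hint
    have hp : ∀ y : K', ∃ p q : K[X], y = aeval (ev ξ) p / aeval (ev ξ) q := by
      intro y
      have hy : y ∈ IntermediateField.adjoin K {ev ξ} := by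
        rw [htop]; trivial
      exact (IntermediateField.mem_adjoin_simple_iff K y).1 hy
    choose p q hpq using hp
    have hF : (p '' E ∪ q '' E).Finite := (hE.image p).union (hE.image q)
    obtain ⟨N, hN⟩ := (hF.image natDegree).bddAbove
    have hN' : ∀ f ∈ p '' E ∪ q '' E, f.natDegree < N + 1 := fun f hf =>
      Nat.lt_succ_of_le (hN ⟨f, hf, rfl⟩)
    obtain ⟨C, hC, hCu, -⟩ := hv.exists_isAdmissible hξ hunit hx (Nat.le_add_left 1 N)
      (fun f hf _ h0 => hint (IsAlgebraic.isIntegral ⟨f, hf, h0⟩)) hF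
    refine ⟨C.map (ev.restrictScalars V), ?_, fun y hy => ?_, hle C hC⟩
    · obtain ⟨e⟩ := hker C
      -- The minimal polynomial is zero, so the kernel is `V`-torsion in a domain, hence zero.
      have hbot : (⊥ : Ideal C) = RingHom.ker ((ev.restrictScalars V).comp C.val) := by
        rw [eq_comm, eq_bot_iff]
        rintro ⟨y, hy⟩ hy0
        obtain ⟨δ, hδ, w, hw, hyw⟩ := hC.exists_mul_eq y hy hy0
        rw [hmin, map_zero, zero_mul, mul_eq_zero,
          map_eq_zero_iff _ (algebraMap_injective_of_isFractionRing V K A)] at hyw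
        exact Subtype.ext (hyw.resolve_left hδ)
      exact hC.isCompleteIntersection.of_algEquiv
        ((AlgEquiv.quotientBot V C).symm.trans ((Ideal.quotientEquivAlgOfEq V hbot).trans e))
    · by_cases hy0 : y = 0
      · rw [hy0]
        exact zero_mem _
      have hp0 : p y ≠ 0 := by
        intro h0
        apply hy0
        rw [hpq y, h0, map_zero, zero_div]
      have hq0 : q y ≠ 0 := by
        intro h0
        apply hy0
        rw [hpq y, h0, map_zero, div_zero]
      obtain ⟨k, u, hu, u', hu', h1, h2⟩ := hCu (p y) (Or.inl ⟨y, hy, rfl⟩) hp0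
        (hN' _ (Or.inl ⟨y, hy, rfl⟩))
      obtain ⟨l, s, hs, s', hs', h3, h4⟩ := hCu (q y) (Or.inr ⟨y, hy, rfl⟩) hq0
        (hN' _ (Or.inr ⟨y, hy, rfl⟩))
      have h5 : ev s' = (ev s)⁻¹ := by
        refine eq_inv_of_mul_eq_one_right ?_
        rw [← map_mul, h3, map_one]
      have h6 : y = algebraMap K K' (k / l) * ev (u * s') := by
        rw [hpq y, ← hevξ, ← hevξ, h2, h4, map_mul, map_mul, AlgHom.commutes, AlgHom.commutes,
          map_mul, h5, map_div₀]
        ring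
      have h7 : v (ev (u * s')) = 1 := hC.map_eq_one (mul_mem hu hs') (mul_mem hu' hs)
        (by linear_combination s' * s * h1 + h3)
      have h8 := hE1 y hy
      rw [h6, map_mul, h7, mul_one] at h8
      rw [h6]
      exact hmem C _ _ (mul_mem hu hs') h8

end PopescuVal

/-! ### Descent to `V'` and the conclusion. -/

section
open Polynomial

namespace PopescuVal

/-- The family is that of all complete intersection subalgebras. They are of finite type, so one
containing generators of two others is an upper bound. -/
theorem isFilteredUnion_of_finite {V : Type u} {V' : Type v} [CommRing V] [CommRing V']
    [Algebra V V'] (h : ∀ E : Set V', E.Finite → ∃ C : Subalgebra V V',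
      IsCompleteIntersectionAlgebra V C ∧ E ⊆ C) :
    IsFilteredUnionOfCompleteIntersections V V' := by
  refine ⟨{C | IsCompleteIntersectionAlgebra V C}, ?_, ?_, fun C hC => hC, fun b => ?_⟩
  · obtain ⟨C, hC, -⟩ := h ∅ Set.finite_empty
    exact ⟨C, hC⟩
  · intro C₁ h₁ C₂ h₂
    obtain ⟨s₁, hs₁⟩ := (Subalgebra.fg_iff_finiteType C₁).2 (IsCompleteIntersectionAlgebra.finiteType h₁)
    obtain ⟨s₂, hs₂⟩ := (Subalgebra.fg_iff_finiteType C₂).2 (IsCompleteIntersectionAlgebra.finiteType h₂)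
    obtain ⟨C, hC, hE⟩ := h (s₁ ∪ s₂) (s₁.finite_toSet.union s₂.finite_toSet)
    refine ⟨C, hC, ?_, ?_⟩
    · rw [← hs₁]
      exact Algebra.adjoin_le (Set.subset_union_left.trans hE)
    · rw [← hs₂]
      exact Algebra.adjoin_le (Set.subset_union_right.trans hE)
  · obtain ⟨C, hC, hE⟩ := h {b} (Set.finite_singleton b)
    exact ⟨C, hC, hE rfl⟩

/-- The local ring of `K[X]` at the kernel of the evaluation at `x`. -/
theorem exists_local_evaluation (K : Type w) {K' : Type*} [Field K] [Field K'] [Algebra K K']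
    (x : K') : ∃ (A : Type w) (_ : CommRing A) (_ : IsDomain A) (_ : Algebra K A)
      (ev : A →ₐ[K] K') (ξ : A), ev ξ = x ∧ Function.Injective (aeval ξ : K[X] →ₐ[K] A) ∧
        ∀ a : A, ev a ≠ 0 → IsUnit a := by
  let P : Ideal K[X] := RingHom.ker (aeval x : K[X] →ₐ[K] K')
  have : P.IsPrime := RingHom.ker_isPrime _
  let A := Localization.AtPrime P
  have hdom : IsDomain A := IsLocalization.isDomain_localization P.primeCompl_le_nonZeroDivisors
  have hu : ∀ y : P.primeCompl, IsUnit ((aeval x : K[X] →ₐ[K] K') y) := fun y =>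
    isUnit_iff_ne_zero.2 y.2
  let ev : A →ₐ[K] K' := IsLocalization.liftAlgHom (M := P.primeCompl) (f := aeval x) hu
  have hξ : ∀ p : K[X], aeval (algebraMap K[X] A X) p = algebraMap K[X] A p := fun p => by
    rw [aeval_algebraMap_apply, aeval_X_left_apply]
  have hev : ∀ p : K[X], ev (algebraMap K[X] A p) = aeval x p := fun p =>
    IsLocalization.lift_eq _ p
  refine ⟨A, inferInstance, hdom, inferInstance, ev, algebraMap K[X] A X, ?_, ?_, ?_⟩
  · rw [hev, aeval_X]
  · intro p q hpq
    rw [hξ, hξ] at hpq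
    exact IsLocalization.injective A P.primeCompl_le_nonZeroDivisors hpq
  · intro a ha
    obtain ⟨p, s, rfl⟩ := IsLocalization.exists_mk'_eq P.primeCompl a
    rw [IsLocalization.AtPrime.isUnit_mk'_iff A P]
    intro hp
    apply ha
    have h1 := congrArg ev (IsLocalization.mk'_spec A p s)
    rw [map_mul, hev, hev] at h1
    rw [show aeval x p = 0 from hp] at h1
    exact (mul_eq_zero.1 h1).resolve_right s.2

section

variable {V : Type*} {V' : Type*} {K : Type*} {K' : Type*}
  [CommRing V] [IsDomain V] [ValuationRing V] [CommRing V'] [IsDomain V'] [ValuationRing V']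
  [Field K] [Field K'] [Algebra V K] [IsFractionRing V K] [Algebra V' K'] [IsFractionRing V' K']
  [Algebra V V'] [Algebra K K'] [Algebra V K'] [IsScalarTower V V' K'] [IsScalarTower V K K']

theorem IsImmediateExtension.isImmediateValuation (h : IsImmediateExtension V V' K K') :
    IsImmediateValuation V K (ValuationRing.valuation V' K') := by
  have hmap : ∀ a : V, algebraMap K K' (algebraMap V K a) = algebraMap V' K' (algebraMap V V' a) :=
    fun a => by rw [← IsScalarTower.algebraMap_apply, ← IsScalarTower.algebraMap_apply]
  have hle : ∀ a : V, ValuationRing.valuation V' K' (algebraMap K K' (algebraMap V K a)) ≤ 1 :=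
    fun a => (ValuationRing.mem_integer_iff V' K' _).2 ⟨_, (hmap a).symm⟩
  have hex : ∀ y : K', ∃ c : K, ValuationRing.valuation V' K' (algebraMap K K' c) =
      ValuationRing.valuation V' K' y := by
    intro y
    obtain ⟨⟨c⟩, hc⟩ := h.bijective_valueGroup.2 (ValuationRing.valuation V' K' y)
    exact ⟨c, hc⟩
  refine ⟨fun c => ⟨fun hc => ?_, ?_⟩, hex, fun y hy => ?_⟩
  · rcases ValuationRing.isInteger_or_isInteger V c with ⟨a, ha⟩ | ⟨a, ha⟩
    · exact ⟨a, ha⟩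
    · by_cases hc0 : c = 0
      · exact ⟨0, by rw [map_zero, hc0]⟩
      have := h.isLocalHom
      obtain ⟨b, hb⟩ := (ValuationRing.mem_integer_iff V' K' _).1 hc
      have hu : IsUnit (algebraMap V V' a) := by
        refine IsUnit.of_mul_eq_one b (IsFractionRing.injective V' K' ?_)
        rw [map_mul, hb, ← hmap, ha, ← map_mul, inv_mul_cancel₀ hc0, map_one, map_one]
      obtain ⟨a', ha'⟩ := ((isUnit_map_iff (algebraMap V V') a).1 hu).exists_right_inv
      refine ⟨a', ?_⟩
      have h1 := congrArg (algebraMap V K) ha'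
      rw [map_mul, ha, map_one] at h1
      rw [← mul_one c, ← h1, ← mul_assoc, mul_inv_cancel₀ hc0, one_mul]
  · rintro ⟨a, rfl⟩
    exact hle a
  -- Equality of value groups makes `y / c` a unit of `V'`; an element `a` of `V` with the same
  -- residue makes `a * c` the required approximation.
  · obtain ⟨c, hc⟩ := hex y
    have hvy : ValuationRing.valuation V' K' y ≠ 0 := by simpa using hy
    have hc0 : algebraMap K K' c ≠ 0 := by
      intro h0
      rw [h0, map_zero] at hc
      exact hvy hc.symm
    obtain ⟨b, hb⟩ := (ValuationRing.mem_integer_iff V' K' (y / algebraMap K K' c)).1 (by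
      rw [Valuation.mem_integer_iff, map_div₀, hc, div_self hvy])
    obtain ⟨r, hr⟩ := h.bijective_residueField.2 (IsLocalRing.residue V' b)
    obtain ⟨a, rfl⟩ := IsLocalRing.residue_surjective r
    rw [IsLocalRing.ResidueField.map_residue, eq_comm, ← sub_eq_zero, ← map_sub,
      IsLocalRing.residue_eq_zero_iff, IsLocalRing.mem_maximalIdeal, mem_nonunits_iff] at hr
    refine ⟨algebraMap V K a * c, ?_⟩
    have hy' : y - algebraMap K K' (algebraMap V K a * c) =
        algebraMap V' K' (b - algebraMap V V' a) * algebraMap K K' c := by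
      rw [map_sub, hb, map_mul, hmap, sub_mul, div_mul_cancel₀ _ hc0]
    rw [hy', map_mul, hc]
    refine mul_lt_of_lt_one_left (zero_lt_iff.2 hvy) (lt_of_not_ge fun hge => hr ?_)
    obtain ⟨b', hb'⟩ := (ValuationRing.mem_integer_iff V' K'
      (algebraMap V' K' (b - algebraMap V V' a))⁻¹).1 (by
        rw [Valuation.mem_integer_iff, map_inv₀]
        exact inv_le_one_of_one_le₀ hge)
    refine IsUnit.of_mul_eq_one b' (IsFractionRing.injective V' K' ?_)
    rw [map_mul, hb', map_one, mul_inv_cancel₀]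
    intro h0
    rw [h0, map_zero] at hge
    exact absurd hge (not_le.2 zero_lt_one)

end

end PopescuVal

end

theorem proposition2p4 {V : Type u} {V' : Type v} {K : Type w} {K' : Type*}
    [CommRing V] [IsDomain V] [ValuationRing V]
    [CommRing V'] [IsDomain V'] [ValuationRing V']
    [Field K] [Field K'] [Algebra V K] [IsFractionRing V K] [Algebra V' K'] [IsFractionRing V' K']
    [Algebra V V'] [Algebra K K'] [Algebra V K'] [IsScalarTower V V' K'] [IsScalarTower V K K']
    (himm : PopescuVal.IsImmediateExtension V V' K K')
    (x : K') (hx : IntermediateField.adjoin K {x} = ⊤) :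
    PopescuVal.IsFilteredUnionOfCompleteIntersections V V' := by
  have hv := himm.isImmediateValuation
  -- Otherwise `x⁻¹` is integral and generates the same field.
  wlog hx1 : ValuationRing.valuation V' K' x ≤ 1 generalizing x
  · refine this x⁻¹ ?_ ?_
    · rw [eq_top_iff, ← hx, IntermediateField.adjoin_simple_le_iff]
      simpa using inv_mem (IntermediateField.mem_adjoin_simple_self K x⁻¹)
    · rw [map_inv₀]
      exact inv_le_one_of_one_le₀ (le_of_not_ge hx1)
  refine PopescuVal.isFilteredUnion_of_finite fun E hE => ?_
  obtain ⟨A, _, _, _, ev, ξ, rfl, hξ, hunit⟩ := PopescuVal.exists_local_evaluation K x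
  let _ : Algebra V A := ((algebraMap K A).comp (algebraMap V K)).toAlgebra
  have : IsScalarTower V K A := IsScalarTower.of_algebraMap_eq fun _ => rfl
  obtain ⟨D, hD, hED, hDv⟩ := hv.exists_subalgebra _ hξ hunit hx1 hx
    (hE.image (algebraMap V' K')) (by
      rintro _ ⟨y, _, rfl⟩
      exact (ValuationRing.mem_integer_iff V' K' _).2 ⟨y, rfl⟩)
  let φ : V' →ₐ[V] K' := IsScalarTower.toAlgHom V V' K'
  have hφ : Function.Injective φ := IsFractionRing.injective V' K'
  have hmap : (D.comap φ).map φ = D := by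
    rw [Subalgebra.map_comap_eq, inf_eq_left]
    intro y hy
    obtain ⟨b, hb⟩ := (ValuationRing.mem_integer_iff V' K' y).1 (hDv y hy)
    exact ⟨b, hb⟩
  refine ⟨D.comap φ, hD.of_algEquiv ?_, fun y hy => hED _ ⟨y, hy, rfl⟩⟩
  exact ((Subalgebra.equivMapOfInjective _ φ hφ).trans (Subalgebra.equivOfEq _ _ hmap)).symm
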